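/- Let $\mu$ be a probability measure on $\mathbb{R}$ with finite second moment and positive variance (so that correlations between variables of law $\mu$ are defined). Assume that $\mu$ is symmetric, i.e. there is $c\in\mathbb{R}$ such that $\mu$ is invariant under $x\mapsto 2c-x$, and unimodal, i.e. there is $m\in\mathbb{R}$ such that the distribution function $F(x)=\mu((-\infty,x])$ is convex on $(-\infty,m)$ and concave on $(m,\infty)$. Then $\mu$ is $3$-universal: for every real symmetric positive semidefinite $3\times 3$ matrix $R=(r_{ij})$ with $r_{11}=r_{22}=r_{33}=1$, there exists a random vector $(X_1,X_2,X_3)$ such that each $X_i$ has law $\mu$ and $$\frac{\operatorname{Cov}(X_i,X_j)}{\sqrt{\operatorname{Var}(X_i)}\,\sqrt{\operatorname{Var}(X_j)}}=r_{ij}\qquad\text{for all } i,j\in\{1,2,3\}.$$ -/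

import Mathlib

open MeasureTheory ProbabilityTheory

noncomputable section

/-- A law on the real line is symmetric if it is invariant under the reflection
`x ↦ 2 * c - x` about some centre `c`. -/
def IsSymmetricLaw (μ : Measure ℝ) : Prop :=
  ∃ c : ℝ, μ.map (fun x => 2 * c - x) = μ

/-- A law on the real line is unimodal if for some mode `m` its distribution function is
convex on `(-∞, m)` and concave on `(m, ∞)`. An atom at `m` is allowed. -/
def IsUnimodalLaw (μ : Measure ℝ) : Prop :=
  ∃ m : ℝ, ConvexOn ℝ (Set.Iio m) (fun x => cdf μ x) ∧
    ConcaveOn ℝ (Set.Ioi m) (fun x => cdf μ x)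

/-- The correlation matrices of order `n`: positive semidefinite matrices with unit diagonal. -/
def IsCorrelationMatrix {n : ℕ} (R : Matrix (Fin n) (Fin n) ℝ) : Prop :=
  R.PosSemidef ∧ ∀ i, R i i = 1

/-- The Pearson correlation coefficient of two real random variables. -/
def correlation {Ω : Type*} [MeasurableSpace Ω] (X Y : Ω → ℝ) (P : Measure Ω) : ℝ :=
  cov[X, Y; P] / (√(Var[X; P]) * √(Var[Y; P]))

/-- The joint law `ν` has a well-defined correlation matrix (each coordinate is square integrable
with positive variance), and this matrix is `R`. -/
def HasCorrelationMatrix {n : ℕ} (ν : Measure (Fin n → ℝ)) (R : Matrix (Fin n) (Fin n) ℝ) :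
    Prop :=
  (∀ i, MemLp (fun x : Fin n → ℝ => x i) 2 ν ∧ 0 < Var[fun x : Fin n → ℝ => x i; ν]) ∧
    ∀ i j, correlation (fun x : Fin n → ℝ => x i) (fun x : Fin n → ℝ => x j) ν = R i j

/-- A law `μ` on the real line is `n`-universal if every correlation matrix of order `n` is the
correlation matrix of some joint law on `ℝⁿ` all of whose one-dimensional marginals are `μ`. -/
def IsNUniversal (n : ℕ) (μ : Measure ℝ) : Prop :=
  ∀ R : Matrix (Fin n) (Fin n) ℝ, IsCorrelationMatrix R →
    ∃ ν : Measure (Fin n → ℝ), IsProbabilityMeasure ν ∧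
      (∀ i, ν.map (fun x => x i) = μ) ∧ HasCorrelationMatrix ν R

end

/-! Centre `μ` at `c`. The centred law `q` is symmetric with tail convex on `(0, ∞)`, so by
Khinchine it is the law of `A * U`, with `A ≥ 0` almost surely and `U` an independent uniform
variable on `[-1, 1]` (`exists_map_mul_symmUniform`). By Archimedes, `U` has the law of `⟪v, S⟫` for
every unit vector `v`, where `S` is uniform on the unit sphere of three-space
(`map_inner_div_norm_stdGaussian`); this is where order 3 enters. With `S` independent of `A`, every
projection of `Y = A • S` on a unit vector has law `q` (`exists_isotropic`).

A correlation matrix is the Gram matrix of unit vectors `v i`. The variables `c + ⟪v i, Y⟫` have law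
`μ`, and polarising `Var ⟪w, Y⟫ = ‖w‖ ^ 2 * Var q` shows that their correlations are `⟪v i, v j⟫ = R
i j`.

The law of `A` is explicit. If `T` is the tail of `|A * U|`, the derivative of `u * T (x / u)` in
`u` is the height at 0 of the tangent to `T` at `x / u`. These heights decrease to 0 and serve as
the tail of `A`. -/

open Set Filter Topology in
/-- Two symmetric probability laws with the same right tails are equal. -/
theorem eq_of_symmetric_of_tail {p q : Measure ℝ} [IsProbabilityMeasure p] [IsProbabilityMeasure q]
    (hp : p.map (fun x => -x) = p) (hq : q.map (fun x => -x) = q)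
    (h : ∀ x, 0 < x → p.real (Ioi x) = q.real (Ioi x)) : p = q := by
  have hpos : ∀ x, 0 < x → cdf p x = cdf q x := fun x hx => by
    have := h x hx
    rw [← compl_Iic, probReal_compl_eq_one_sub measurableSet_Iic,
      probReal_compl_eq_one_sub measurableSet_Iic] at this
    rw [cdf_eq_real, cdf_eq_real]; linarith
  -- Reflection turns `Iic x` into the closed ray `Ici (-x)`, hence the left limit; an atom at `-x`
  -- must not be lost.
  have hneg : ∀ (r : Measure ℝ) [IsProbabilityMeasure r], r.map (fun x => -x) = r →
      ∀ x, cdf r x = 1 - Function.leftLim (cdf r) (-x) := by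
    intro r _ hr x
    have h1 : r (Iic x) = r (Ici (-x)) := by
      conv_lhs => rw [← hr]
      rw [Measure.map_apply measurable_neg measurableSet_Iic]
      congr 1; ext y; simp
    rw [cdf_eq_real, Measure.real, h1]
    conv_lhs => rw [← measure_cdf r]
    rw [(cdf r).measure_Ici (tendsto_cdf_atTop r), ENNReal.toReal_ofReal]
    have := (monotone_cdf r).leftLim_le (le_refl (-x))
    linarith [cdf_le_one r (-x)]
  refine Measure.eq_of_cdf p q ?_
  ext x
  rcases lt_trichotomy x 0 with hx | rfl | hx
  · rw [hneg p hp, hneg q hq]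
    congr 1
    refine tendsto_nhds_unique ((monotone_cdf p).tendsto_leftLim (-x)) ?_
    refine ((monotone_cdf q).tendsto_leftLim (-x)).congr' ?_
    filter_upwards [nhdsWithin_le_nhds (lt_mem_nhds (show 0 < -x by linarith))] with y hy
    exact (hpos y hy).symm
  · have hl : ∀ r : Measure ℝ, Tendsto (cdf r) (𝓝[>] 0) (𝓝 (cdf r 0)) := fun r =>
      ((cdf r).right_continuous 0).mono_left (nhdsWithin_mono _ Ioi_subset_Ici_self)
    refine tendsto_nhds_unique (hl p) ((hl q).congr' ?_)
    filter_upwards [self_mem_nhdsWithin] with y hy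
    exact (hpos y hy).symm
  · exact hpos x hx

/-! ### Convex tails as scale mixtures of uniform tails -/

section Tangent

open Set Filter Topology

/-- The height at `0` of the left tangent line to the graph of `T` at `y`. -/
noncomputable def tangentIntercept (T : ℝ → ℝ) (y : ℝ) : ℝ := T y - y * derivWithin T (Iio y) y

variable {T : ℝ → ℝ}

lemma tangent_le (hT : ConvexOn ℝ (Ioi 0) T) {x y : ℝ} (hx : 0 < x) (hxy : x < y) :
    T y + derivWithin T (Iio y) y * (x - y) ≤ T x := by
  have h := hT.slope_le_leftDeriv_of_mem_interior (x := x) (y := y) hx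
    (by rw [interior_Ioi]; exact hx.trans hxy) hxy
  rw [slope_def_field, div_le_iff₀ (by linarith)] at h
  linarith

lemma leftDeriv_nonpos (hA : Antitone T) (y : ℝ) : derivWithin T (Iio y) y ≤ 0 :=
  (hA.antitoneOn _).derivWithin_nonpos

/-- The tangent at the farther point passes below the graph at the nearer one and is flatter, so it
meets the vertical axis lower. -/
lemma tangentIntercept_antitoneOn (hT : ConvexOn ℝ (Ioi 0) T) :
    AntitoneOn (tangentIntercept T) (Ioi 0) := by
  intro y hy z hz hyz
  rcases hyz.eq_or_lt with rfl | hyz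
  · rfl
  have h1 := tangent_le hT hy hyz
  have h2 := hT.monotoneOn_leftDeriv (by rwa [interior_Ioi]) (by rwa [interior_Ioi]) hyz.le
  simp only [tangentIntercept]
  have h3 := mul_le_mul_of_nonneg_left h2 (le_of_lt hy)
  simp only at h3
  linarith

lemma tangentIntercept_nonneg (hA : Antitone T) {y : ℝ} (h0 : 0 ≤ T y) (hy : 0 < y) :
    0 ≤ tangentIntercept T y := by
  have := mul_nonneg hy.le (neg_nonneg.2 (leftDeriv_nonpos hA y))
  simp only [tangentIntercept]
  linarith

lemma tangentIntercept_le_one (hT : ConvexOn ℝ (Ioi 0) T) (h1 : ∀ x, 0 < x → T x ≤ 1)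
    {y : ℝ} (hy : 0 < y) : tangentIntercept T y ≤ 1 := by
  have hl : Tendsto (fun x => T y + derivWithin T (Iio y) y * (x - y)) (𝓝[>] 0)
      (𝓝 (T y + derivWithin T (Iio y) y * (0 - y))) :=
    Tendsto.mono_left (Continuous.tendsto (by fun_prop) 0) nhdsWithin_le_nhds
  have : T y + derivWithin T (Iio y) y * (0 - y) ≤ 1 := by
    refine le_of_tendsto hl ?_
    filter_upwards [Ioo_mem_nhdsGT hy] with x hx
    exact (tangent_le hT hx.1 hx.2).trans (h1 x hx.1)
  simp only [tangentIntercept]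
  linarith

/-- The tangent at `y` lies below the graph at `y / 2`, which bounds the intercept by `2 * T (y /
2)`. -/
lemma tendsto_tangentIntercept (hT : ConvexOn ℝ (Ioi 0) T) (hA : Antitone T)
    (h0 : ∀ x, 0 ≤ T x) (hlim : Tendsto T atTop (𝓝 0)) :
    Tendsto (tangentIntercept T) atTop (𝓝 0) := by
  have hl : Tendsto (fun y => 2 * T (y / 2)) atTop (𝓝 (2 * 0)) :=
    (hlim.comp (tendsto_id.atTop_div_const (by norm_num))).const_mul 2
  rw [mul_zero] at hl
  refine tendsto_of_tendsto_of_tendsto_of_le_of_le' tendsto_const_nhds hl ?_ ?_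
  · filter_upwards [eventually_gt_atTop 0] with y hy
    exact tangentIntercept_nonneg hA (h0 y) hy
  · filter_upwards [eventually_gt_atTop 0] with y hy
    have := tangent_le hT (half_pos hy) (half_lt_self hy)
    have := h0 y
    simp only [tangentIntercept]
    linarith

/-- The tail at `x` is the average of the tangent intercepts at the points `x / u`. -/
lemma integral_tangentIntercept (hT : ConvexOn ℝ (Ioi 0) T) (hA : Antitone T)
    (h0 : ∀ x, 0 ≤ T x) (h1 : ∀ x, 0 < x → T x ≤ 1) {x : ℝ} (hx : 0 < x) :
    ∫ u in (0 : ℝ)..1, tangentIntercept T (x / u) = T x := by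
  have hc : ContinuousOn T (Ioi 0) := hT.continuousOn isOpen_Ioi
  have hcont : ContinuousOn (fun u => u * T (x / u)) (uIcc 0 1) := by
    rw [uIcc_of_le zero_le_one]
    intro u hu
    rcases hu.1.eq_or_lt with rfl | hu0
    -- At `u = 0` the value is 0 whatever `T (x / 0)` is, and nearby `0 ≤ u * T (x / u) ≤ u`.
    · have : Tendsto (fun u => u * T (x / u)) (𝓝[Icc 0 1] 0) (𝓝 0) := by
        have hid : Tendsto (fun u : ℝ => u) (𝓝[Icc 0 1] 0) (𝓝 0) :=
          tendsto_id.mono_left nhdsWithin_le_nhds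
        refine squeeze_zero' ?_ ?_ hid
        · filter_upwards [self_mem_nhdsWithin] with u hu
          exact mul_nonneg hu.1 (h0 _)
        · filter_upwards [self_mem_nhdsWithin] with u hu
          rcases hu.1.eq_or_lt with rfl | hu0
          · simp
          · exact mul_le_of_le_one_right hu.1 (h1 _ (by positivity))
      simpa [ContinuousWithinAt] using this
    · refine ContinuousAt.continuousWithinAt ?_
      refine continuousAt_id.mul (ContinuousAt.comp (g := T) (f := fun u => x / u) ?_ ?_)
      · exact hc.continuousAt (Ioi_mem_nhds (by positivity))
      · exact continuousAt_const.div continuousAt_id hu0.ne'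
  -- As `u ↦ x / u` is decreasing, a right derivative in `u` calls for the left derivative of `T`.
  have hderiv : ∀ u ∈ Ioo (min (0 : ℝ) 1) (max 0 1),
      HasDerivWithinAt (fun u => u * T (x / u)) (tangentIntercept T (x / u)) (Ioi u) u := by
    intro u hu
    simp only [zero_le_one, inf_of_le_left, sup_of_le_right] at hu
    have hu0 : 0 < u := hu.1
    have hT' : HasDerivWithinAt T (derivWithin T (Iio (x / u)) (x / u)) (Iio (x / u)) (x / u) :=
      hT.hasDerivWithinAt_leftDeriv_of_mem_interior (by rw [interior_Ioi]; exact div_pos hx hu0)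
    have hd : HasDerivWithinAt (fun u => x / u) (-x / u ^ 2) (Ioi u) u := by
      have := ((hasDerivAt_inv hu0.ne').const_mul x).hasDerivWithinAt (s := Ioi u)
      simpa only [div_eq_mul_inv, mul_neg, neg_mul] using this
    have hcomp := hT'.scomp u hd (fun v hv => by
      exact div_lt_div_of_pos_left hx hu0 hv)
    have := (hasDerivWithinAt_id u (Ioi u)).mul hcomp
    refine this.congr_deriv ?_
    simp only [tangentIntercept, id, Function.comp, smul_eq_mul]
    field_simp
    ring
  have hmono : MonotoneOn (fun u => tangentIntercept T (x / u)) (Ioo 0 1) := by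
    intro u hu v hv huv
    exact tangentIntercept_antitoneOn hT (div_pos hx hv.1) (div_pos hx hu.1)
      (div_le_div_of_nonneg_left hx.le hu.1 huv)
  have hint : IntervalIntegrable (fun u => tangentIntercept T (x / u)) volume 0 1 := by
    rw [intervalIntegrable_iff_integrableOn_Ioo_of_le zero_le_one]
    refine IntegrableOn.of_bound (C := 1) (by simp)
      (aemeasurable_restrict_of_monotoneOn measurableSet_Ioo hmono).aestronglyMeasurable ?_
    filter_upwards [ae_restrict_mem measurableSet_Ioo] with u hu
    rw [Real.norm_eq_abs, abs_of_nonneg (tangentIntercept_nonneg hA (h0 _) (div_pos hx hu.1))]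
    exact tangentIntercept_le_one hT h1 (div_pos hx hu.1)
  rw [intervalIntegral.integral_eq_sub_of_hasDeriv_right hcont hderiv hint]
  simp

/-- A convex tail on `(0, ∞)` is a mixture of the tails of uniform laws on intervals `[0, a]`. -/
theorem exists_scale_mixture (hT : ConvexOn ℝ (Ioi 0) T) (hA : Antitone T)
    (h0 : ∀ x, 0 ≤ T x) (h1 : ∀ x, 0 < x → T x ≤ 1) (hlim : Tendsto T atTop (𝓝 0)) :
    ∃ l : Measure ℝ, IsProbabilityMeasure l ∧ l (Iio 0) = 0 ∧
      ∀ x, 0 < x → ∫ u in (0 : ℝ)..1, l.real (Ioi (x / u)) = T x := by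
  classical
  -- Up to right continuity, the distribution function of the mixing law. A jump at 0 gives the
  -- mixing law an atom there, which accounts for an atom of the mixture at the centre.
  set k : ℝ → ℝ := fun y => if 0 < y then 1 - tangentIntercept T y else 0 with hk
  have hmono : Monotone k := by
    intro y z hyz
    simp only [hk]
    split_ifs with hy hz hz
    · linarith [tangentIntercept_antitoneOn hT hy hz hyz]
    · linarith
    · linarith [tangentIntercept_le_one hT h1 hz]
    · rfl
  set F := hmono.stieltjesFunction with hF
  have hF0 : ∀ y < 0, F y = 0 := by
    intro y hy
    rw [hF, hmono.stieltjesFunction_eq]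
    refine tendsto_nhds_unique (hmono.tendsto_rightLim y) (tendsto_const_nhds.congr' ?_)
    filter_upwards [Ioo_mem_nhdsGT hy] with z hz
    simp [hk, hz.2.le]
  have hbot : Tendsto F atBot (𝓝 0) := by
    refine tendsto_const_nhds.congr' ?_
    filter_upwards [eventually_lt_atBot 0] with y hy
    exact (hF0 y hy).symm
  have hktop : Tendsto k atTop (𝓝 1) := by
    have := (tendsto_tangentIntercept hT hA h0 hlim).const_sub 1
    rw [sub_zero] at this
    refine this.congr' ?_
    filter_upwards [eventually_gt_atTop 0] with y hy
    simp [hk, hy]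
  have htop : Tendsto F atTop (𝓝 1) := by
    refine tendsto_of_tendsto_of_tendsto_of_le_of_le hktop
      (hktop.comp (tendsto_atTop_add_const_right _ 1 tendsto_id)) (fun y => ?_) (fun y => ?_)
    · exact hmono.le_rightLim le_rfl
    · exact hmono.rightLim_le (by simp)
  have hP : IsProbabilityMeasure F.measure := F.isProbabilityMeasure hbot htop
  refine ⟨F.measure, hP, ?_, fun x hx => ?_⟩
  · rw [F.measure_Iio hbot]
    have : Function.leftLim F 0 = 0 := by
      refine tendsto_nhds_unique (F.mono.tendsto_leftLim 0) (tendsto_const_nhds.congr' ?_)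
      filter_upwards [self_mem_nhdsWithin] with z hz
      exact (hF0 z hz).symm
    simp [this]
  · rw [← integral_tangentIntercept hT hA h0 h1 hx]
    refine intervalIntegral.integral_congr_ae ?_
    -- `F` agrees with `k` where `k` is continuous, and a monotone function has only countably many
    -- discontinuities, so the integrals agree.
    have hcount : {u : ℝ | ¬ ContinuousAt k (x / u)}.Countable := by
      have := hmono.countable_not_continuousAt.image (fun y => x / y)
      refine this.mono ?_
      intro u hu
      exact ⟨x / u, hu, div_div_cancel₀ hx.ne'⟩
    filter_upwards [hcount.ae_notMem volume] with u hu hu1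
    rw [uIoc_of_le zero_le_one] at hu1
    have hcont : ContinuousAt k (x / u) := by simpa using hu
    have hFk : F (x / u) = k (x / u) :=
      tendsto_nhds_unique (hmono.tendsto_rightLim _)
        (hcont.tendsto.mono_left nhdsWithin_le_nhds)
    have hxu : 0 < x / u := div_pos hx hu1.1
    have hkx : k (x / u) = 1 - tangentIntercept T (x / u) := by simp only [hk, if_pos hxu]
    rw [Measure.real, F.measure_Ioi htop, hFk, hkx, sub_sub_cancel,
      ENNReal.toReal_ofReal (tangentIntercept_nonneg hA (h0 _) hxu)]

end Tangent

/-! ### Gaussian measure of discs and cones -/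

section Archimedes

open Set Filter Topology Real

lemma measureReal_prod_eq_integral {α β : Type*} [MeasurableSpace α] [MeasurableSpace β]
    (μ : Measure α) (ν : Measure β) [IsProbabilityMeasure μ] [IsProbabilityMeasure ν]
    {s : Set (α × β)} (hs : MeasurableSet s) :
    (μ.prod ν).real s = ∫ x, ν.real (Prod.mk x ⁻¹' s) ∂μ := by
  rw [Measure.real, Measure.prod_apply hs, ← integral_toReal]
  · rfl
  · exact (measurable_measure_prodMk_left hs).aemeasurable
  · exact ae_of_all _ fun x => measure_lt_top _ _

/-- The squared radius of a standard planar Gaussian vector is exponentially distributed. -/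
lemma gaussian_prod_disc {s : ℝ} (hs : 0 ≤ s) :
    ((gaussianReal 0 1).prod (gaussianReal 0 1)).real {p : ℝ × ℝ | p.1 ^ 2 + p.2 ^ 2 < s} =
      1 - exp (-(s / 2)) := by
  have hm : MeasurableSet {p : ℝ × ℝ | p.1 ^ 2 + p.2 ^ 2 < s} :=
    measurableSet_lt (by fun_prop) (by fun_prop)
  have hroot : ∀ r : ℝ, 0 < r → (r ^ 2 < s ↔ r < √s) := fun r hr => (Real.lt_sqrt hr.le).symm
  have hpdf : ∀ p : ℝ × ℝ, gaussianPDFReal 0 1 p.1 * gaussianPDFReal 0 1 p.2 =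
      (2 * π)⁻¹ * exp (-(p.1 ^ 2 + p.2 ^ 2) / 2) := by
    intro p
    simp only [gaussianPDFReal, NNReal.coe_one, mul_one, sub_zero]
    rw [mul_mul_mul_comm, ← exp_add, ← mul_inv, Real.mul_self_sqrt (by positivity)]
    congr 2; ring
  rw [← integral_indicator_one hm, gaussianReal_of_var_ne_zero 0 one_ne_zero,
    prod_withDensity (measurable_gaussianPDF 0 1) (measurable_gaussianPDF 0 1),
    integral_withDensity_eq_integral_toReal_smul
      (f := fun z : ℝ × ℝ => gaussianPDF 0 1 z.1 * gaussianPDF 0 1 z.2)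
      (((measurable_gaussianPDF 0 1).comp measurable_fst).mul
        ((measurable_gaussianPDF 0 1).comp measurable_snd))
      (ae_of_all _ fun p => ENNReal.mul_lt_top gaussianPDF_lt_top gaussianPDF_lt_top),
    ← Measure.volume_eq_prod, ← integral_comp_polarCoord_symm]
  have hint : ∀ p ∈ polarCoord.target,
      p.1 • ((gaussianPDF 0 1 (polarCoord.symm p).1 * gaussianPDF 0 1 (polarCoord.symm p).2).toReal •
        {p : ℝ × ℝ | p.1 ^ 2 + p.2 ^ 2 < s}.indicator (1 : ℝ × ℝ → ℝ) (polarCoord.symm p)) =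
      (Iio (√s)).indicator (fun r => r * exp (-(r ^ 2 / 2))) p.1 * (fun _ => (2 * π)⁻¹) p.2 := by
    intro p hp
    have hp1 : 0 < p.1 := hp.1
    have hsq : (p.1 * cos p.2) ^ 2 + (p.1 * sin p.2) ^ 2 = p.1 ^ 2 := by
      rw [mul_pow, mul_pow, ← mul_add, cos_sq_add_sin_sq, mul_one]
    have hd := hpdf (polarCoord.symm p)
    simp only [polarCoord_symm_apply, hsq] at hd
    rw [ENNReal.toReal_mul, toReal_gaussianPDF, toReal_gaussianPDF]
    simp only [polarCoord_symm_apply, hd, smul_eq_mul, indicator, mem_ofPred_eq, hsq, hroot _ hp1,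
      mem_Iio, Pi.one_apply]
    split_ifs
    · rw [neg_div]; ring
    · simp
  rw [setIntegral_congr_fun polarCoord.open_target.measurableSet hint, polarCoord_target,
    Measure.volume_eq_prod]
  refine (setIntegral_prod_mul (Iio (√s)|>.indicator fun r => r * exp (-(r ^ 2 / 2)))
    (fun _ => (2 * π)⁻¹) _ _).trans ?_
  have h2 : ∫ _ in Ioo (-π) π, (2 * π)⁻¹ = (1 : ℝ) := by
    rw [setIntegral_const, measureReal_def, Real.volume_Ioo, ENNReal.toReal_ofReal (by linarith [pi_pos]),
      smul_eq_mul]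
    field_simp
    ring
  have h1 : ∫ r in Ioi 0, (Iio (√s)).indicator (fun r => r * exp (-(r ^ 2 / 2))) r =
      1 - exp (-(s / 2)) := by
    rw [setIntegral_indicator measurableSet_Iio, Ioi_inter_Iio, ← integral_Ioc_eq_integral_Ioo,
      ← intervalIntegral.integral_of_le (sqrt_nonneg s),
      intervalIntegral.integral_eq_sub_of_hasDerivAt (f := fun r => -exp (-(r ^ 2 / 2)))]
    · rw [Real.sq_sqrt hs]; simp; ring
    · intro r _
      have := ((((hasDerivAt_id r).pow 2).div_const 2).neg.exp).neg
      refine this.congr_deriv ?_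
      simp
      ring
    · exact Continuous.intervalIntegrable (by fun_prop) _ _
  rw [h1, h2, mul_one]

/-- The height of a standard Gaussian vector in space, divided by its norm, exceeds `t` with
probability `(1 - t) / 2`. -/
lemma gaussian_prod_cone {t : ℝ} (ht : 0 < t) :
    ((gaussianReal 0 1).prod ((gaussianReal 0 1).prod (gaussianReal 0 1))).real
      {x : ℝ × ℝ × ℝ | t * √(x.1 ^ 2 + (x.2.1 ^ 2 + x.2.2 ^ 2)) < x.1} = (1 - min t 1) / 2 := by
  rcases le_or_gt 1 t with h1 | h1
  · rw [min_eq_right h1, sub_self, zero_div]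
    have : {x : ℝ × ℝ × ℝ | t * √(x.1 ^ 2 + (x.2.1 ^ 2 + x.2.2 ^ 2)) < x.1} = ∅ := by
      ext x
      simp only [mem_ofPred_eq, mem_empty_iff_false, iff_false, not_lt]
      calc x.1 ≤ √(x.1 ^ 2 + (x.2.1 ^ 2 + x.2.2 ^ 2)) := Real.le_sqrt_of_sq_le (by nlinarith)
        _ ≤ _ := le_mul_of_one_le_left (sqrt_nonneg _) h1
    rw [this, measureReal_empty]
  rw [min_eq_left h1.le, measureReal_prod_eq_integral _ _ (measurableSet_lt (by fun_prop) (by fun_prop))]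
  have hk : 0 ≤ 1 / t ^ 2 - 1 := by
    rw [sub_nonneg, le_div_iff₀ (by positivity)]; nlinarith
  -- At height `z > 0` the cone cuts out a disc of squared radius `z ^ 2 * (1 / t ^ 2 - 1)`.
  have hslice : ∀ z : ℝ, ((gaussianReal 0 1).prod (gaussianReal 0 1)).real
      (Prod.mk z ⁻¹' {x : ℝ × ℝ × ℝ | t * √(x.1 ^ 2 + (x.2.1 ^ 2 + x.2.2 ^ 2)) < x.1}) =
      (Ioi 0).indicator (fun z => 1 - exp (-(z ^ 2 * (1 / t ^ 2 - 1) / 2))) z := by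
    intro z
    by_cases hz : 0 < z
    · rw [indicator_of_mem (show z ∈ Ioi 0 from hz), ← gaussian_prod_disc (by positivity)]
      congr 1
      ext p
      simp only [mem_preimage, mem_ofPred_eq]
      rw [← lt_div_iff₀' ht, Real.sqrt_lt' (div_pos hz ht), div_pow, mul_sub, mul_one_div, mul_one,
        lt_sub_iff_add_lt']
    · rw [indicator_of_notMem (show z ∉ Ioi 0 from hz)]
      convert measureReal_empty
      ext p
      simp only [mem_preimage, mem_ofPred_eq, mem_empty_iff_false, iff_false, not_lt]
      exact (not_lt.1 hz).trans (by positivity)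
  simp_rw [hslice]
  rw [integral_gaussianReal_eq_integral_smul one_ne_zero]
  -- The exponents combine to leave two half-line Gaussian integrals, of standard deviations 1 and
  -- `t`.
  have hfun : (fun z => gaussianPDFReal 0 1 z •
      (Ioi 0).indicator (fun z => 1 - exp (-(z ^ 2 * (1 / t ^ 2 - 1) / 2))) z) =
      (Ioi 0).indicator (fun z => (√(2 * π))⁻¹ *
        (exp (-(1 / 2) * z ^ 2) - exp (-(1 / (2 * t ^ 2)) * z ^ 2))) := by
    ext z
    simp only [indicator, smul_eq_mul]
    split_ifs
    · simp only [gaussianPDFReal, NNReal.coe_one, mul_one, sub_zero]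
      rw [mul_assoc, mul_sub, mul_one, ← exp_add]
      congr 3
      · ring
      · field_simp; ring
    · simp
  rw [hfun, integral_indicator measurableSet_Ioi, integral_const_mul, integral_sub
    (integrable_exp_neg_mul_sq (by norm_num)).integrableOn
    (integrable_exp_neg_mul_sq (by positivity)).integrableOn, integral_gaussian_Ioi,
    integral_gaussian_Ioi]
  have e1 : √(π / (1 / 2)) = √(2 * π) := by congr 1; ring
  have e2 : √(π / (1 / (2 * t ^ 2))) = t * √(2 * π) := by
    rw [show π / (1 / (2 * t ^ 2)) = t ^ 2 * (2 * π) by field_simp, Real.sqrt_mul (by positivity),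
      Real.sqrt_sq ht.le]
  rw [e1, e2]
  have : √(2 * π) ≠ 0 := by positivity
  field_simp

end Archimedes

/-! ### Archimedes, Khinchine and isotropic laws -/

section Isotropic

open Set Filter Topology Real
open scoped RealInnerProductSpace

/-- The uniform law on `[-1, 1]`. -/
noncomputable def symmUniform : Measure ℝ := (2⁻¹ : ENNReal) • volume.restrict (Icc (-1) 1)

instance : IsProbabilityMeasure symmUniform := by
  refine ⟨?_⟩
  rw [symmUniform, Measure.smul_apply, Measure.restrict_apply_univ, Real.volume_Icc]
  norm_num
  exact ENNReal.inv_mul_cancel (by simp) (by simp)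

lemma symmUniform_map_neg : symmUniform.map (fun x => -x) = symmUniform := by
  have h : MeasurePreserving (fun x : ℝ => -x) volume volume := Measure.measurePreserving_neg volume
  have h' := h.restrict_preimage (s := Icc (-1) 1) measurableSet_Icc
  have hs : (fun x : ℝ => -x) ⁻¹' Icc (-1) 1 = Icc (-1) 1 := by
    ext x; simp only [mem_preimage, mem_Icc]; constructor <;> rintro ⟨h1, h2⟩ <;> constructor <;> linarith
  rw [hs] at h'
  rw [symmUniform, Measure.map_smul, h'.map_eq]

lemma symmUniform_tail {x : ℝ} (hx : 0 < x) : symmUniform.real (Ioi x) = (1 - min x 1) / 2 := by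
  have hs : Ioi x ∩ Icc (-1) 1 = Ioc x 1 := by
    ext y; simp only [mem_inter_iff, mem_Ioi, mem_Icc, mem_Ioc]
    constructor
    · rintro ⟨h1, h2, h3⟩; exact ⟨h1, h3⟩
    · rintro ⟨h1, h3⟩; exact ⟨h1, by linarith, h3⟩
  rw [Measure.real, symmUniform, Measure.smul_apply, Measure.restrict_apply measurableSet_Ioi, hs,
    Real.volume_Ioc, smul_eq_mul, ENNReal.toReal_mul]
  rcases le_total x 1 with h | h
  · rw [min_eq_left h, ENNReal.toReal_ofReal (by linarith)]; simp; ring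
  · rw [min_eq_right h, ENNReal.ofReal_of_nonpos (by linarith)]; simp

lemma measurePreserving_pi_fin_three (γ : Measure ℝ) [IsProbabilityMeasure γ] :
    MeasurePreserving (fun x : Fin 3 → ℝ => (x 0, x 1, x 2)) (Measure.pi fun _ => γ)
      (γ.prod (γ.prod γ)) :=
  ((MeasurePreserving.id γ).prod (measurePreserving_finTwoArrow γ)).comp
    (measurePreserving_piFinSuccAbove (fun _ : Fin 3 => γ) 0)

/-- Archimedes: the projection on an axis of a uniform random point of the unit sphere in space is
uniform. The point is obtained by normalizing a standard Gaussian vector. -/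
theorem map_inner_div_norm_stdGaussian {v : EuclideanSpace ℝ (Fin 3)} (hv : ‖v‖ = 1) :
    (stdGaussian (EuclideanSpace ℝ (Fin 3))).map (fun g => ⟪v, g⟫ / ‖g‖) = symmUniform := by
  have hmeas : Measurable fun g : EuclideanSpace ℝ (Fin 3) => ⟪v, g⟫ / ‖g‖ := by fun_prop
  have := Measure.isProbabilityMeasure_map
    (μ := stdGaussian (EuclideanSpace ℝ (Fin 3))) hmeas.aemeasurable
  refine eq_of_symmetric_of_tail ?_ symmUniform_map_neg fun t ht => ?_
  · rw [Measure.map_map measurable_neg hmeas]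
    conv_rhs => rw [← stdGaussian_map (LinearIsometryEquiv.neg ℝ (E := EuclideanSpace ℝ (Fin 3))),
      Measure.map_map hmeas (LinearIsometryEquiv.continuous _).measurable]
    congr 1
    ext g
    simp [neg_div]
  -- The standard Gaussian has independent standard coordinates in any orthonormal basis, so `v` may
  -- be taken as first axis.
  obtain ⟨b, hb⟩ := Orthonormal.exists_orthonormalBasis_extension_of_card_eq (𝕜 := ℝ)
    (E := EuclideanSpace ℝ (Fin 3)) (ι := Fin 3) (by simp) (v := fun _ => v) (s := {0})
    ⟨fun i => hv, fun i j hij => (hij (Subsingleton.elim i j)).elim⟩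
  have hb0 : b 0 = v := hb 0 rfl
  have hg : Measurable fun x : Fin 3 → ℝ => ∑ i, x i • b i := by fun_prop
  rw [symmUniform_tail ht, ← gaussian_prod_cone ht, stdGaussian_eq_map_pi_orthonormalBasis b,
    Measure.map_map hmeas hg, ← (measurePreserving_pi_fin_three (gaussianReal 0 1)).map_eq,
    Measure.real, Measure.real, Measure.map_apply (hmeas.comp hg) measurableSet_Ioi,
    Measure.map_apply (by fun_prop) (measurableSet_lt (by fun_prop) (by fun_prop))]
  congr 2
  ext x
  have hin : ⟪v, ∑ i, x i • b i⟫ = x 0 := by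
    rw [← hb0, b.orthonormal.inner_right_fintype]
  have hn : ‖∑ i, x i • b i‖ = √(x 0 ^ 2 + (x 1 ^ 2 + x 2 ^ 2)) := by
    rw [← Real.sqrt_sq (norm_nonneg (∑ i, x i • b i)), ← real_inner_self_eq_norm_sq,
      b.orthonormal.inner_sum, Fin.sum_univ_three]
    congr 1
    simp; ring
  simp only [mem_preimage, Function.comp, mem_Ioi, mem_ofPred_eq, hin, hn]
  -- At the origin the quotient is 0 by convention, and the point lies in neither set.
  rcases (sqrt_nonneg (x 0 ^ 2 + (x 1 ^ 2 + x 2 ^ 2))).eq_or_lt with h0 | h0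
  · have hx0 : x 0 = 0 := by
      have := (Real.sqrt_eq_zero (by positivity)).1 h0.symm
      nlinarith [sq_nonneg (x 0), sq_nonneg (x 1), sq_nonneg (x 2)]
    rw [← h0, hx0]
    simp [ht.le]
  · exact lt_div_iff₀ h0

/-- Khinchine: a symmetric law whose tail is convex on `(0, ∞)` is the law of a product of
independent variables, one of them uniform on `[-1, 1]`. -/
theorem exists_map_mul_symmUniform (q : Measure ℝ) [IsProbabilityMeasure q]
    (hq : q.map (fun x => -x) = q) (hconv : ConvexOn ℝ (Ioi 0) fun x => q.real (Ioi x)) :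
    ∃ l : Measure ℝ, IsProbabilityMeasure l ∧
      (symmUniform.prod l).map (fun z => z.2 * z.1) = q := by
  -- Twice the tail of `q` is the tail of the absolute value; the density `1 / 2` of `symmUniform`
  -- later cancels the factor.
  have hle : ∀ x, 0 < x → 2 * q.real (Ioi x) ≤ 1 := by
    intro x hx
    have h1 : q.real (Ioi x) = q.real (Iio (-x)) := by
      rw [Measure.real, Measure.real]
      conv_lhs => rw [← hq, Measure.map_apply measurable_neg measurableSet_Ioi]
      congr 2; ext y; simp
    have h2 : q.real (Ioi x ∪ Iio (-x)) = q.real (Ioi x) + q.real (Iio (-x)) :=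
      measureReal_union (by
        rw [Set.disjoint_left]; intro y hy hy'
        simp only [mem_Ioi, mem_Iio] at hy hy'; linarith) measurableSet_Iio
    have := measureReal_le_one (μ := q) (s := Ioi x ∪ Iio (-x))
    linarith
  have hlim : Tendsto (fun x => 2 * q.real (Ioi x)) atTop (𝓝 0) := by
    have h1 : ∀ x, q.real (Ioi x) = 1 - cdf q x := fun x => by
      rw [← compl_Iic, probReal_compl_eq_one_sub measurableSet_Iic, cdf_eq_real]
    simp_rw [h1]
    have := ((tendsto_cdf_atTop q).const_sub 1).const_mul 2
    simpa using this
  obtain ⟨l, hl, hl0, htail⟩ := exists_scale_mixture (T := fun x => 2 * q.real (Ioi x))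
    (hconv.smul (by norm_num : (0 : ℝ) ≤ 2))
    (fun x y hxy => mul_le_mul_of_nonneg_left (measureReal_mono (Ioi_subset_Ioi hxy)) (by norm_num))
    (fun x => by positivity) hle hlim
  have hm : Measurable fun z : ℝ × ℝ => z.2 * z.1 := by fun_prop
  have hP := Measure.isProbabilityMeasure_map (μ := symmUniform.prod l) hm.aemeasurable
  refine ⟨l, hl, eq_of_symmetric_of_tail ?_ hq fun x hx => ?_⟩
  · rw [Measure.map_map measurable_neg hm]
    conv_rhs => rw [← symmUniform_map_neg]
    have := Measure.map_prod_map symmUniform l measurable_neg measurable_id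
    rw [Measure.map_id] at this
    rw [this, Measure.map_map hm (by fun_prop)]
    congr 1
    ext z
    simp
  · have hslice : ∀ u, l.real (Prod.mk u ⁻¹' ((fun z : ℝ × ℝ => z.2 * z.1) ⁻¹' Ioi x)) =
        (Ioi 0).indicator (fun u => l.real (Ioi (x / u))) u := by
      intro u
      by_cases hu : 0 < u
      · rw [indicator_of_mem (show u ∈ Ioi 0 from hu)]
        congr 1; ext a; simp [div_lt_iff₀ hu]
      · rw [indicator_of_notMem (show u ∉ Ioi 0 from hu), Measure.real]
        have : l (Prod.mk u ⁻¹' ((fun z : ℝ × ℝ => z.2 * z.1) ⁻¹' Ioi x)) = 0 := by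
          refine measure_mono_null (fun a ha => ?_) hl0
          simp only [mem_preimage, mem_Ioi] at ha
          by_contra h
          have := mul_nonpos_of_nonneg_of_nonpos (not_lt.1 h) (not_lt.1 hu)
          linarith
        rw [this, ENNReal.toReal_zero]
    rw [Measure.real, Measure.map_apply hm measurableSet_Ioi, ← Measure.real,
      measureReal_prod_eq_integral _ _ (hm measurableSet_Ioi)]
    simp_rw [hslice]
    have hs : Icc (-1 : ℝ) 1 ∩ Ioi 0 = Ioc 0 1 := by
      ext y; simp only [mem_inter_iff, mem_Ioi, mem_Icc, mem_Ioc]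
      constructor
      · rintro ⟨⟨h1, h2⟩, h3⟩; exact ⟨h3, h2⟩
      · rintro ⟨h1, h3⟩; exact ⟨⟨by linarith, h3⟩, h1⟩
    rw [symmUniform, integral_smul_measure, setIntegral_indicator measurableSet_Ioi, hs,
      ← intervalIntegral.integral_of_le zero_le_one, htail x hx]
    simp

/-- Every symmetric law whose tail is convex on `(0, ∞)` is the common law of all the projections
on axes of some law on Euclidean space of dimension three. -/
theorem exists_isotropic (q : Measure ℝ) [IsProbabilityMeasure q]
    (hq : q.map (fun x => -x) = q) (hconv : ConvexOn ℝ (Ioi 0) fun x => q.real (Ioi x)) :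
    ∃ r : Measure (EuclideanSpace ℝ (Fin 3)), IsProbabilityMeasure r ∧
      ∀ v : EuclideanSpace ℝ (Fin 3), ‖v‖ = 1 → r.map (fun g => ⟪v, g⟫) = q := by
  obtain ⟨l, hl, hprod⟩ := exists_map_mul_symmUniform q hq hconv
  have hm : Measurable fun z : EuclideanSpace ℝ (Fin 3) × ℝ => (z.2 / ‖z.1‖) • z.1 := by fun_prop
  refine ⟨((stdGaussian (EuclideanSpace ℝ (Fin 3))).prod l).map fun z => (z.2 / ‖z.1‖) • z.1,
    Measure.isProbabilityMeasure_map hm.aemeasurable, fun v hv => ?_⟩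
  have hd : Measurable fun g : EuclideanSpace ℝ (Fin 3) => ⟪v, g⟫ / ‖g‖ := by fun_prop
  have := Measure.map_prod_map (stdGaussian (EuclideanSpace ℝ (Fin 3))) l hd measurable_id
  rw [Measure.map_id, map_inner_div_norm_stdGaussian hv] at this
  rw [← hprod, this, Measure.map_map (by fun_prop) hm, Measure.map_map (by fun_prop)
    (hd.prodMap measurable_id)]
  congr 1
  ext z
  simp only [Function.comp, real_inner_smul_right, Prod.map, id]
  ring

end Isotropic

/-! ### Centring, Gram vectors and covariances -/

section Universality

open Set Filter Topology
open scoped RealInnerProductSpace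

lemma map_sub_centre_map_neg {μ : Measure ℝ} {c : ℝ} (hc : μ.map (fun x => 2 * c - x) = μ) :
    (μ.map fun x => x - c).map (fun x => -x) = μ.map fun x => x - c := by
  rw [Measure.map_map (by fun_prop) (by fun_prop)]
  conv_rhs => rw [← hc, Measure.map_map (by fun_prop) (by fun_prop)]
  congr 1
  ext x
  simp only [Function.comp]
  ring

/-- The tail of a symmetric unimodal law is convex to the right of its centre. -/
lemma convexOn_tail_of_symmetric_unimodal {μ : Measure ℝ} [IsProbabilityMeasure μ] {c : ℝ}
    (hc : μ.map (fun x => 2 * c - x) = μ) (hunim : IsUnimodalLaw μ) :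
    ConvexOn ℝ (Ioi 0) fun x => (μ.map fun x => x - c).real (Ioi x) := by
  obtain ⟨m, hconv, hconc⟩ := hunim
  have htail : ∀ x, (μ.map fun x => x - c).real (Ioi x) = 1 - cdf μ (c + x) := by
    intro x
    rw [map_measureReal_apply (by fun_prop) measurableSet_Ioi, cdf_eq_real,
      ← probReal_compl_eq_one_sub measurableSet_Iic, compl_Iic]
    congr 1; ext y; simp [add_comm]
  -- The mode need not be the centre. If `m ≤ c`, concavity right of `m` suffices; otherwise
  -- convexity left of `m` is reflected about `c`.
  rcases le_or_gt m c with hmc | hmc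
  · refine ⟨convex_Ioi 0, fun x hx y hy a b ha hb hab => ?_⟩
    have := hconc.2 (show c + x ∈ Ioi m from hmc.trans_lt (by simpa using hx))
      (show c + y ∈ Ioi m from hmc.trans_lt (by simpa using hy)) ha hb hab
    rw [show a • (c + x) + b • (c + y) = c + (a • x + b • y) by
      simp only [smul_eq_mul]; linear_combination c * hab] at this
    simp only [htail, smul_eq_mul] at this ⊢
    linarith
  · have htail' : ∀ x, 0 < x → (μ.map fun x => x - c).real (Ioi x) = cdf μ (c - x) := by
      intro x hx
      -- Convexity on an open ray gives continuity, so `c - x` carries no mass and `Iio` may replace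
      -- `Iic`.
      have hcont : ContinuousAt (fun x => cdf μ x) (c - x) :=
        (hconv.continuousOn isOpen_Iio).continuousAt (Iio_mem_nhds (by linarith))
      have hleft : Function.leftLim (cdf μ) (c - x) = cdf μ (c - x) :=
        tendsto_nhds_unique ((monotone_cdf μ).tendsto_leftLim _)
          (hcont.tendsto.mono_left nhdsWithin_le_nhds)
      have hIio : μ.real (Iio (c - x)) = cdf μ (c - x) := by
        rw [Measure.real]
        conv_lhs => rw [← measure_cdf μ]
        rw [(cdf μ).measure_Iio (tendsto_cdf_atBot μ), hleft, sub_zero,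
          ENNReal.toReal_ofReal (cdf_nonneg μ _)]
      rw [← hIio, map_measureReal_apply (by fun_prop) measurableSet_Ioi]
      conv_lhs => rw [← hc, map_measureReal_apply (by fun_prop)
        (measurableSet_preimage (by fun_prop) measurableSet_Ioi)]
      congr 1; ext y; simp only [mem_preimage, mem_Ioi, mem_Iio]
      constructor <;> intro h <;> linarith
    refine ⟨convex_Ioi 0, fun x hx y hy a b ha hb hab => ?_⟩
    have hxy : a • x + b • y ∈ Ioi (0 : ℝ) := convex_Ioi 0 hx hy ha hb hab
    rw [mem_Ioi] at hx hy hxy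
    have := hconv.2 (show c - x ∈ Iio m by rw [mem_Iio]; linarith)
      (show c - y ∈ Iio m by rw [mem_Iio]; linarith) ha hb hab
    rw [show a • (c - x) + b • (c - y) = c - (a • x + b • y) by
      simp only [smul_eq_mul]; linear_combination c * hab] at this
    simp only [htail' x hx, htail' y hy, htail' _ hxy]
    exact this

/-- A positive semidefinite matrix is the Gram matrix of some vectors. -/
lemma exists_inner_eq_of_posSemidef {n : ℕ} {R : Matrix (Fin n) (Fin n) ℝ} (hR : R.PosSemidef) :
    ∃ v : Fin n → EuclideanSpace ℝ (Fin n), ∀ i j, ⟪v i, v j⟫ = R i j := by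
  obtain ⟨B, hB⟩ : ∃ B : Matrix (Fin n) (Fin n) ℝ, R = B.conjTranspose * B := by
    open scoped MatrixOrder in
    exact CStarAlgebra.nonneg_iff_eq_star_mul_self.1 hR.nonneg
  refine ⟨fun i => WithLp.toLp 2 fun k => B k i, fun i j => ?_⟩
  rw [hB, Matrix.mul_apply, PiLp.inner_apply]
  simp [mul_comm]

section IsotropicCovariance

variable {E : Type*} [NormedAddCommGroup E] [InnerProductSpace ℝ E] [MeasurableSpace E]
  [BorelSpace E] [SecondCountableTopology E] {r : Measure E} {q : Measure ℝ}

lemma memLp_inner (hr : ∀ v : E, ‖v‖ = 1 → r.map (fun g => ⟪v, g⟫) = q)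
    (hq : MemLp (fun x : ℝ => x) 2 q) {v : E} (hv : ‖v‖ = 1) : MemLp (fun g => ⟪v, g⟫) 2 r := by
  rw [← hr v hv, memLp_map_measure_iff (by fun_prop) (by fun_prop)] at hq
  exact hq

/-- Vectors of arbitrary length are needed because polarisation uses `v + w`, which is not a unit
vector. -/
lemma variance_inner [IsProbabilityMeasure r]
    (hr : ∀ v : E, ‖v‖ = 1 → r.map (fun g => ⟪v, g⟫) = q) (w : E) :
    Var[fun g => ⟪w, g⟫; r] = ‖w‖ ^ 2 * Var[fun x => x; q] := by
  rcases eq_or_ne w 0 with rfl | hw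
  · simp [← Pi.zero_def]
  · have hn : ‖(‖w‖⁻¹ • w)‖ = 1 := norm_smul_inv_norm (𝕜 := ℝ) hw
    have hw' : (fun g => ⟪w, g⟫) = fun g => ‖w‖ * ⟪‖w‖⁻¹ • w, g⟫ := by
      ext g
      rw [real_inner_smul_left, mul_inv_cancel_left₀ (norm_ne_zero_iff.2 hw)]
    rw [hw', variance_const_mul, ← hr _ hn, variance_map (by fun_prop) (by fun_prop)]
    rfl

/-- The covariances of the projections of an isotropic law are given by inner products. -/
lemma covariance_inner [IsProbabilityMeasure r]
    (hr : ∀ v : E, ‖v‖ = 1 → r.map (fun g => ⟪v, g⟫) = q) (hq : MemLp (fun x : ℝ => x) 2 q)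
    {v w : E} (hv : ‖v‖ = 1) (hw : ‖w‖ = 1) :
    cov[fun g => ⟪v, g⟫, fun g => ⟪w, g⟫; r] = ⟪v, w⟫ * Var[fun x => x; q] := by
  have h := variance_add (memLp_inner hr hq hv) (memLp_inner hr hq hw)
  have hsum : (fun g => ⟪v, g⟫) + (fun g => ⟪w, g⟫) = fun g => ⟪v + w, g⟫ := by
    ext g; simp [inner_add_left]
  rw [hsum, variance_inner hr, variance_inner hr, variance_inner hr, norm_add_sq_real] at h
  linear_combination -h / 2

end IsotropicCovariance

end Universality

theorem mainTheorem6 (μ : Measure ℝ) [IsProbabilityMeasure μ]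
    (hsymm : IsSymmetricLaw μ) (hunim : IsUnimodalLaw μ)
    (hmom : MemLp (fun x : ℝ => x) 2 μ) (hvar : 0 < Var[fun x : ℝ => x; μ]) :
    IsNUniversal 3 μ := by
  intro R hR
  obtain ⟨c, hc⟩ := hsymm
  have hsub : Measurable fun x : ℝ => x - c := by fun_prop
  have := Measure.isProbabilityMeasure_map (μ := μ) hsub.aemeasurable
  obtain ⟨r, hr, hmarg⟩ := exists_isotropic (μ.map fun x => x - c) (map_sub_centre_map_neg hc)
    (convexOn_tail_of_symmetric_unimodal hc hunim)
  obtain ⟨v, hv⟩ := exists_inner_eq_of_posSemidef hR.1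
  -- The unit diagonal of `R` makes the Gram vectors unit vectors, so each projection has the
  -- centred law.
  have hnorm : ∀ i, ‖v i‖ = 1 := fun i => by
    have h := hv i i
    rw [hR.2 i, real_inner_self_eq_norm_sq] at h
    exact (pow_eq_one_iff_of_nonneg (norm_nonneg _) two_ne_zero).1 h
  have hmom' : MemLp (fun x : ℝ => x) 2 (μ.map fun x => x - c) := by
    rw [memLp_map_measure_iff (by fun_prop) (by fun_prop)]
    exact hmom.sub (memLp_const c)
  have hvar' : Var[fun x : ℝ => x; μ.map fun x => x - c] = Var[fun x : ℝ => x; μ] := by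
    rw [variance_map (by fun_prop) (by fun_prop)]
    exact variance_sub_const (by fun_prop) c
  set X : EuclideanSpace ℝ (Fin 3) → Fin 3 → ℝ := fun g i => c + inner ℝ (v i) g with hX
  have hXm : Measurable X := by fun_prop
  have hcoord : ∀ i, (r.map X).map (fun x => x i) = μ := fun i => by
    rw [Measure.map_map (by fun_prop) hXm]
    have h1 : (fun x : Fin 3 → ℝ => x i) ∘ X = (fun x => c + x) ∘ fun g => inner ℝ (v i) g := rfl
    rw [h1, ← Measure.map_map (by fun_prop) (by fun_prop), hmarg _ (hnorm i),
      Measure.map_map (by fun_prop) hsub]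
    have h2 : (fun x => c + x) ∘ (fun x : ℝ => x - c) = id := by ext x; simp
    rw [h2, Measure.map_id]
  have hev : ∀ i, Measurable fun x : Fin 3 → ℝ => x i := measurable_pi_apply
  have hLp : ∀ i, MemLp (fun x : Fin 3 → ℝ => x i) 2 (r.map X) := fun i => by
    have h := hmom
    rw [← hcoord i, memLp_map_measure_iff (by fun_prop) (hev i).aemeasurable] at h
    exact h
  have hVar : ∀ i, Var[fun x : Fin 3 → ℝ => x i; r.map X] = Var[fun x : ℝ => x; μ] := fun i => by
    conv_rhs => rw [← hcoord i, variance_map (by fun_prop) (hev i).aemeasurable]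
    rfl
  refine ⟨r.map X, Measure.isProbabilityMeasure_map hXm.aemeasurable, hcoord,
    fun i => ⟨hLp i, by rw [hVar i]; exact hvar⟩, fun i j => ?_⟩
  have hint : ∀ i, Integrable (fun g => inner ℝ (v i) g) r := fun i =>
    (memLp_inner hmarg hmom' (hnorm i)).integrable (by norm_num)
  have hcov : cov[fun x : Fin 3 → ℝ => x i, fun x : Fin 3 → ℝ => x j; r.map X] =
      R i j * Var[fun x : ℝ => x; μ] := by
    rw [covariance_map (hev i).aestronglyMeasurable (hev j).aestronglyMeasurable hXm.aemeasurable, ← hv i j, ← hvar',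
      ← covariance_inner hmarg hmom' (hnorm i) (hnorm j)]
    exact (covariance_const_add_left (hint i) c).trans (covariance_const_add_right (hint j) c)
  rw [correlation, hcov, hVar i, hVar j, Real.mul_self_sqrt hvar.le, mul_div_cancel_right₀ _ hvar.ne']
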